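/- Let $A,B\in M_2(\mathbb C)$ and suppose that $A$ has real eigenvalues $\lambda_1>0>\lambda_2$. Consider the system $$\frac{d}{dx}\begin{pmatrix} f\\ g\end{pmatrix}=(Ax+B)\begin{pmatrix} f\\ g\end{pmatrix},\qquad f,g:\mathbb R\to\mathbb C. \qquad (*)$$ (a) Suppose that no eigenvector of $A$ for $\lambda_2$ is an eigenvector of $B$. Let $P\in GL(2,\mathbb C)$ be any matrix such that $PAP^{-1}$ is diagonal and write $PBP^{-1}=\begin{pmatrix} b_1&b_2\\ b_3&b_4\end{pmatrix}$. Then $(*)$ has a solution $(f,g)\neq(0,0)$ with $f,g\in L^2(\mathbb R)$ if and only if $b_2b_3=(\lambda_1-\lambda_2)\,n$ for some integer $n<0$. (b) If some eigenvector of $A$ for $\lambda_2$ is also an eigenvector of $B$ (equivalently, $b_2=0$ when $PAP^{-1}=\mathrm{diag}(\lambda_1,\lambda_2)$), then $(*)$ has a solution $(f,g)\neq(0,0)$ with $f,g\in L^2(\mathbb R)$. (c) For every solution $(f,g)$ of $(*)$ with $f,g\in L^2(\mathbb R)$, both $f$ and $g$ are Schwartz functions. -/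

import Mathlib

open MeasureTheory

/-- `(f, g)` is a solution on the whole real line of `(f, g)' = (A x + B) (f, g)`. -/
def IsSolution (A B : Matrix (Fin 2) (Fin 2) ℂ) (f g : ℝ → ℂ) : Prop :=
  ∀ x : ℝ, HasDerivAt (fun t : ℝ => ![f t, g t])
    (((x : ℂ) • A + B).mulVec ![f x, g x]) x

/-- `(f, g)` is a solution with both components in `L²(ℝ)`. -/
def IsL2Solution (A B : Matrix (Fin 2) (Fin 2) ℂ) (f g : ℝ → ℂ) : Prop :=
  IsSolution A B f g ∧ MemLp f 2 volume ∧ MemLp g 2 volume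

/-- The system has a pair of square-integrable solutions `f, g`, not both zero. -/
def HasNonzeroL2Solution (A B : Matrix (Fin 2) (Fin 2) ℂ) : Prop :=
  ∃ f g : ℝ → ℂ, IsL2Solution A B f g ∧ (f ≠ 0 ∨ g ≠ 0)

/-- `h` is (the underlying function of) a Schwartz function. -/
def IsSchwartz (h : ℝ → ℂ) : Prop :=
  ∃ F : SchwartzMap ℝ ℂ, ∀ x, F x = h x

/-- Some eigenvector of `A` for the eigenvalue `l` is also an eigenvector of `B`.
If `P A P⁻¹ = diag (l₁, l)` with `l₁ ≠ l`, this says that the upper right entry of `P B P⁻¹`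
is zero. -/
def SharesEigenvector (A B : Matrix (Fin 2) (Fin 2) ℂ) (l : ℂ) : Prop :=
  ∃ (v : Fin 2 → ℂ) (m : ℂ), Module.End.HasEigenvector (Matrix.toLin' A) l v ∧
    Module.End.HasEigenvector (Matrix.toLin' B) m v

/-!
In a basis of eigenvectors of `A` the system reads `u' = (l₁ x + b₁) u + b₂ v`,
`v' = b₃ u + (l₂ x + b₄) v`. If `b₂ = 0`, then `u = 0`, `v = exp (l₂ x² / 2 + b₄ x)` is a
square-integrable solution. If `b₂ ≠ 0` and `b₂ b₃ = (l₁ - l₂) n` with `n < 0`, a Hermite polynomial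
of degree `-n - 1` in a rescaled variable, times the same Gaussian, is the first component of one.

Conversely, for a square-integrable solution the function `p = exp (-(l₁ x² / 2 + b₁ x)) u` solves
a second-order equation, has exponential moments of all orders, and integration by parts turns the
equation into a recursion expressing `(b₂ b₃ + (l₁ - l₂) (k + 1)) ∫ xᵏ p` through lower moments. If
none of these factors vanishes, then all moments of `p` are zero, hence so are its Fourier
transform and `p` itself.

For the decay of a square-integrable solution, `|u|² - |v|²` is eventually increasing, so
`|u| ≤ |v|` near infinity, where the equation of `v` then forces `|v|` to decay faster than any
exponential.
Derivatives of a solution are polynomial-coefficient operators applied to the solution itself, and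
inherit the decay.
-/

open Filter

section QuadraticExponential

lemma abs_pow_le_factorial_mul_exp_abs (k : ℕ) (x : ℝ) :
    |x| ^ k ≤ k.factorial * Real.exp |x| := by
  have h := Real.pow_div_factorial_le_exp |x| (abs_nonneg x) k
  rwa [div_le_iff₀' (by positivity)] at h

/-- The nowhere vanishing solution `exp (l x² / 2 + b x)` of the scalar equation
`y' = (l x + b) y`. -/
noncomputable def expQuad (l b : ℂ) (x : ℝ) : ℂ := Complex.exp (l * x ^ 2 / 2 + b * x)

lemma expQuad_ne_zero (l b : ℂ) (x : ℝ) : expQuad l b x ≠ 0 := Complex.exp_ne_zero _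

lemma hasDerivAt_expQuad (l b : ℂ) (x : ℝ) :
    HasDerivAt (expQuad l b) ((l * x + b) * expQuad l b x) x := by
  have hx : HasDerivAt (fun t : ℝ => (t : ℂ)) 1 x := Complex.ofRealCLM.hasDerivAt
  have h := ((((hx.pow 2).const_mul l).div_const 2).add (hx.const_mul b)).cexp
  refine h.congr_deriv ?_
  simp only [expQuad, Pi.add_apply, Pi.pow_apply]
  push_cast
  ring

lemma continuous_expQuad (l b : ℂ) : Continuous (expQuad l b) :=
  continuous_iff_continuousAt.2 fun x => (hasDerivAt_expQuad l b x).continuousAt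

lemma norm_exp_mul_norm_expQuad (l b : ℂ) (R x : ℝ) :
    Real.exp (R * x) * ‖expQuad l b x‖ = ‖expQuad l (b + R) x‖ := by
  simp only [expQuad, Complex.norm_exp, ← Real.exp_add]
  congr 1
  simp only [Complex.add_re, Complex.mul_re, Complex.add_im, Complex.ofReal_re, Complex.ofReal_im]
  ring

lemma memLp_expQuad {l : ℂ} (hl : l.re < 0) (b : ℂ) : MemLp (expQuad l b) 2 := by
  rw [memLp_two_iff_integrable_sq_norm (continuous_expQuad l b).aestronglyMeasurable]
  refine (integrable_cexp_quadratic' hl (2 * b) 0).norm.congr (.of_forall fun x => ?_)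
  simp only [expQuad, ← norm_pow, ← Complex.exp_nat_mul]
  push_cast
  ring_nf

lemma memLp_exp_mul_abs_smul_expQuad {l : ℂ} (hl : l.re < 0) (b : ℂ) (R : ℝ) :
    MemLp (fun x : ℝ => Real.exp (R * |x|) • expQuad l b x) 2 := by
  have hbound : MemLp (fun x => ‖expQuad l (b + R) x‖ + ‖expQuad l (b + (-R : ℝ)) x‖) 2 :=
    (memLp_expQuad hl _).norm.add (memLp_expQuad hl _).norm
  have hcont : Continuous fun x : ℝ => Real.exp (R * |x|) • expQuad l b x :=
    (by fun_prop : Continuous fun x : ℝ => Real.exp (R * |x|)).smul (continuous_expQuad l b)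
  refine hbound.mono' hcont.aestronglyMeasurable (.of_forall fun x => ?_)
  have hexp : Real.exp (R * |x|) ≤ Real.exp (R * x) + Real.exp (-R * x) :=
    calc Real.exp (R * |x|) ≤ Real.exp |R * x| := by
          rw [abs_mul]; gcongr; exact le_abs_self R
      _ ≤ Real.exp (R * x) + Real.exp (-R * x) := by
          rw [neg_mul]; exact Real.exp_abs_le _
  rw [norm_smul, Real.norm_eq_abs, Real.abs_exp, ← norm_exp_mul_norm_expQuad,
    ← norm_exp_mul_norm_expQuad, ← add_mul]
  gcongr

lemma memLp_eval_mul_expQuad {l : ℂ} (hl : l.re < 0) (b : ℂ) (w : Polynomial ℂ) :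
    MemLp (fun x : ℝ => w.eval (x : ℂ) * expQuad l b x) 2 := by
  induction w using Polynomial.induction_on' with
  | add p q hp hq => simp only [Polynomial.eval_add, add_mul]; exact hp.add hq
  | monomial k a =>
    simp only [Polynomial.eval_monomial, mul_assoc]
    refine MemLp.const_mul ?_ a
    refine (memLp_exp_mul_abs_smul_expQuad hl b 1).of_le_mul (c := k.factorial)
      (((by fun_prop : Continuous fun x : ℝ => (x : ℂ) ^ k).mul
        (continuous_expQuad l b)).aestronglyMeasurable) (.of_forall fun x => ?_)
    rw [norm_mul, norm_pow, Complex.norm_real, norm_smul, Real.norm_eq_abs, Real.norm_eq_abs,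
      Real.abs_exp, one_mul, ← mul_assoc]
    gcongr
    exact abs_pow_le_factorial_mul_exp_abs k x

end QuadraticExponential

section Moments

open scoped FourierTransform

variable {E : Type*} [NormedAddCommGroup E] [NormedSpace ℂ E]

/-- `p` has exponential moments of all orders: `x ↦ exp (R |x|) p x` is integrable for every `R`.
If `p` is also continuous, its moments determine it. -/
def HasExpMoments (p : ℝ → E) : Prop := ∀ R : ℝ, Integrable fun x => Real.exp (R * |x|) • p x

/-- The `k`-th moment `∫ xᵏ p x dx` of a vector-valued function on the line, which is `0` if the
integrand is not integrable. -/
noncomputable def moment (k : ℕ) (p : ℝ → E) : E := ∫ x : ℝ, (x : ℂ) ^ k • p x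

lemma moment_const_smul (c : ℂ) (k : ℕ) (p : ℝ → E) :
    moment k (fun x => c • p x) = c • moment k p := by
  simp only [moment, smul_comm _ c, integral_smul]

lemma moment_id_smul (k : ℕ) (p : ℝ → E) :
    moment k (fun x : ℝ => (x : ℂ) • p x) = moment (k + 1) p := by
  simp only [moment, smul_smul, pow_succ]

namespace HasExpMoments

variable {p p' q : ℝ → E}

lemma sub (hp : HasExpMoments p) (hq : HasExpMoments q) : HasExpMoments fun x => p x - q x :=
  fun R => by simp only [smul_sub]; exact (hp R).sub (hq R)

lemma add (hp : HasExpMoments p) (hq : HasExpMoments q) : HasExpMoments fun x => p x + q x :=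
  fun R => by simp only [smul_add]; exact (hp R).add (hq R)

lemma const_smul (hp : HasExpMoments p) (c : ℂ) : HasExpMoments fun x => c • p x :=
  fun R => by simp only [smul_comm _ c]; exact (hp R).smul c

lemma integrable (hp : HasExpMoments p) : Integrable p := by simpa using hp 0

lemma pow_smul (hp : HasExpMoments p) (k : ℕ) : HasExpMoments fun x : ℝ => (x : ℂ) ^ k • p x := by
  intro R
  have hmeas : AEStronglyMeasurable (fun x : ℝ => Real.exp (R * |x|) • (x : ℂ) ^ k • p x) :=
    (by fun_prop : Continuous fun x : ℝ => Real.exp (R * |x|)).aestronglyMeasurable.smul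
      ((by fun_prop : Continuous fun x : ℝ => (x : ℂ) ^ k).aestronglyMeasurable.smul
        hp.integrable.aestronglyMeasurable)
  refine ((hp (R + 1)).norm.const_mul (k.factorial : ℝ)).mono' hmeas (.of_forall fun x => ?_)
  simp only [norm_smul, norm_pow, Complex.norm_real, Real.norm_eq_abs, Real.abs_exp]
  calc Real.exp (R * |x|) * (|x| ^ k * ‖p x‖)
      ≤ Real.exp (R * |x|) * (k.factorial * Real.exp |x| * ‖p x‖) := by
        gcongr; exact abs_pow_le_factorial_mul_exp_abs k x
    _ = k.factorial * (Real.exp ((R + 1) * |x|) * ‖p x‖) := by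
        rw [add_mul, one_mul, Real.exp_add]; ring

lemma moment_sub (hp : HasExpMoments p) (hq : HasExpMoments q) (k : ℕ) :
    moment k (fun x => p x - q x) = moment k p - moment k q := by
  simp only [moment, smul_sub]
  exact integral_sub (hp.pow_smul k).integrable (hq.pow_smul k).integrable

lemma moment_add (hp : HasExpMoments p) (hq : HasExpMoments q) (k : ℕ) :
    moment k (fun x => p x + q x) = moment k p + moment k q := by
  simp only [moment, smul_add]
  exact integral_add (hp.pow_smul k).integrable (hq.pow_smul k).integrable

lemma moment_deriv (hp : HasExpMoments p) (hp' : HasExpMoments p')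
    (h : ∀ x, HasDerivAt p (p' x) x) (k : ℕ) :
    moment k p' = -((k : ℂ) • moment (k - 1) p) := by
  have hderiv (x : ℝ) : HasDerivAt (fun t : ℝ => (t : ℂ) ^ k • p t)
      ((x : ℂ) ^ k • p' x + (k : ℂ) • (x : ℂ) ^ (k - 1) • p x) x := by
    have hpow : HasDerivAt (fun t : ℝ => (t : ℂ) ^ k) (k * (x : ℂ) ^ (k - 1)) x := by
      simpa using (Complex.ofRealCLM.hasDerivAt (x := x)).fun_pow k
    simpa only [mul_smul] using hpow.fun_smul (h x)
  have hint' := (hp'.pow_smul k).integrable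
  have hint := ((hp.pow_smul (k - 1)).const_smul (k : ℂ)).integrable
  have hzero := integral_eq_zero_of_hasDerivAt_of_integrable hderiv (hint'.add hint)
    (hp.pow_smul k).integrable
  rw [integral_add hint' hint, integral_smul] at hzero
  exact eq_neg_of_add_eq_zero_left hzero

/-- Integrate `p'' = β p - (d x + c) p'` against `xᵏ`. For `k ≤ 1` the coefficients of the moments
with truncated index vanish. -/
lemma moment_recursion {β c d : ℂ} (hp : HasExpMoments p) (hq : HasExpMoments q)
    (hpq : ∀ x, HasDerivAt p (q x) x)
    (hqp : ∀ x : ℝ, HasDerivAt q (β • p x - (d * x + c) • q x) x) (k : ℕ) :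
    (β + d * (k + 1)) • moment k p =
      (k * (k - 1 : ℕ) : ℂ) • moment (k - 2) p - (c * k) • moment (k - 1) p := by
  have hxq : HasExpMoments fun x : ℝ => (x : ℂ) • q x := by simpa using hq.pow_smul 1
  have hsplit (x : ℝ) : β • p x - (d * x + c) • q x = β • p x - (d • (x : ℂ) • q x + c • q x) := by
    rw [add_smul, mul_smul]
  have hq' : HasExpMoments fun x : ℝ => β • p x - (d * x + c) • q x := by
    simp only [hsplit]
    exact (hp.const_smul β).sub ((hxq.const_smul d).add (hq.const_smul c))
  have hexpand : moment k (fun x : ℝ => β • p x - (d * x + c) • q x) =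
      β • moment k p - (d • moment (k + 1) q + c • moment k q) := by
    simp only [hsplit]
    rw [moment_sub (hp.const_smul β) ((hxq.const_smul d).add (hq.const_smul c)),
      moment_add (hxq.const_smul d) (hq.const_smul c), moment_const_smul, moment_const_smul,
      moment_const_smul, moment_id_smul]
  have hk := hq.moment_deriv hq' hqp k
  rw [hexpand, hp.moment_deriv hq hpq k, hp.moment_deriv hq hpq (k + 1),
    hp.moment_deriv hq hpq (k - 1), Nat.sub_sub, Nat.add_sub_cancel] at hk
  push_cast at hk
  linear_combination (norm := module) hk

/-- Exponential moments justify integrating the power series of the Fourier kernel term by term. -/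
lemma fourier_eq_zero_of_moment_eq_zero (hp : HasExpMoments p) (hm : ∀ k, moment k p = 0) :
    𝓕 p = 0 := by
  funext ξ
  rw [Real.fourier_real_eq_integral_exp_smul]
  set s : ℂ := -2 * Real.pi * ξ * Complex.I with hs
  have hseries : HasSum (fun k : ℕ => ∫ x : ℝ, (s ^ k / k.factorial) • (x : ℂ) ^ k • p x)
      (∫ x : ℝ, Complex.exp (↑(-2 * Real.pi * x * ξ) * Complex.I) • p x) := by
    refine hasSum_integral_of_dominated_convergence
      (fun k x => (‖s‖ * |x|) ^ k / k.factorial * ‖p x‖)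
      (fun k => ((hp.pow_smul k).const_smul _).integrable.aestronglyMeasurable)
      (fun k => .of_forall fun x => le_of_eq ?_)
      (.of_forall fun x => (Real.summable_pow_div_factorial _).mul_right _)
      ((hp ‖s‖).norm.congr (.of_forall fun x => ?_)) (.of_forall fun x => ?_)
    · simp only [norm_smul, norm_div, norm_pow, Complex.norm_real, Complex.norm_natCast,
        Real.norm_eq_abs]
      ring
    · simp only [norm_smul, Real.norm_eq_abs, Real.abs_exp]
      rw [tsum_mul_right, Real.exp_eq_exp_ℝ, NormedSpace.exp_eq_tsum_div]
    · have hkernel : ↑(-2 * Real.pi * x * ξ) * Complex.I = s * x := by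
        rw [hs]; push_cast; ring
      rw [hkernel, Complex.exp_eq_exp_ℂ]
      refine ((NormedSpace.expSeries_div_hasSum_exp (s * (x : ℂ))).smul_const (p x)).congr_fun
        fun k => ?_
      rw [smul_smul]
      ring_nf
  refine hseries.unique ?_
  simp only [moment] at hm
  simp only [integral_smul, hm, smul_zero, Pi.zero_apply, hasSum_zero]

variable [CompleteSpace E]

theorem eq_zero_of_moment_eq_zero (hp : HasExpMoments p) (hcont : Continuous p)
    (hm : ∀ k, moment k p = 0) : p = 0 := by
  have hF : 𝓕 p = 0 := hp.fourier_eq_zero_of_moment_eq_zero hm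
  have hinv := hcont.fourierInv_fourier_eq hp.integrable (by simp [hF])
  rw [← hinv, hF]
  funext x
  simp [Real.fourierInv_eq]

theorem eq_zero_of_second_order {β c d : ℂ} (hp : HasExpMoments p) (hq : HasExpMoments q)
    (hpq : ∀ x, HasDerivAt p (q x) x)
    (hqp : ∀ x : ℝ, HasDerivAt q (β • p x - (d * x + c) • q x) x)
    (hβ : ∀ k : ℕ, β + d * (k + 1) ≠ 0) : p = 0 := by
  have hcont : Continuous p := continuous_iff_continuousAt.2 fun x => (hpq x).continuousAt
  refine hp.eq_zero_of_moment_eq_zero hcont fun k => ?_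
  induction k using Nat.strong_induction_on with
  | _ k ih =>
    refine (smul_eq_zero_iff_right (hβ k)).1 ?_
    rw [hp.moment_recursion hq hpq hqp k]
    rcases k with _ | k
    · simp
    · rw [ih (k + 1 - 1) (by omega), ih (k + 1 - 2) (by omega), smul_zero, smul_zero, sub_zero]

end HasExpMoments

lemma hasExpMoments_mul_expQuad {l : ℂ} (hl : l.re < 0) (b : ℂ) {u : ℝ → ℂ}
    (hu : MemLp u 2) : HasExpMoments fun x => u x * expQuad l b x := fun R => by
  simp only [← mul_smul_comm]
  exact hu.integrable_mul (memLp_exp_mul_abs_smul_expQuad hl b R)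

end Moments

section Hermite

open Polynomial

lemma derivative_hermite_succ (n : ℕ) :
    derivative (hermite (n + 1)) = C (n + 1 : ℤ) * hermite n := by
  induction n with
  | zero => simp
  | succ n ih =>
    rw [hermite_succ (n + 1), derivative_sub, derivative_mul, derivative_X, ih,
      derivative_C_mul, hermite_succ n]
    push_cast
    simp only [C_add, C_1]
    ring

lemma derivative_derivative_hermite (n : ℕ) :
    derivative (derivative (hermite n)) =
      X * derivative (hermite n) - C (n : ℤ) * hermite n := by
  have h := derivative_hermite_succ n
  rw [hermite_succ, derivative_sub, derivative_mul, derivative_X] at h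
  simp only [C_add, C_1] at h
  linear_combination -h

/-- The witness is the Hermite polynomial of degree `n` in the variable `√d x + c / √d`. -/
lemma exists_ne_zero_derivative_derivative_eq {d : ℂ} (hd : d ≠ 0) (c : ℂ) (n : ℕ) :
    ∃ w : ℂ[X], w ≠ 0 ∧
      derivative (derivative w) = (C d * X + C c) * derivative w - C (d * n) * w := by
  obtain ⟨s, hs⟩ := IsAlgClosed.exists_pow_nat_eq d two_pos
  have hs₀ : s ≠ 0 := by rintro rfl; exact hd (by simpa using hs.symm)
  have hcs : c = s * (c / s) := by field_simp
  set g : ℂ[X] := C s * X + C (c / s)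
  set H : ℂ[X] := (hermite n).map (Int.castRingHom ℂ)
  have hg : derivative g = C s := by simp [g]
  have hH : derivative (derivative H) = X * derivative H - C (n : ℂ) * H := by
    simp only [H, derivative_map, derivative_derivative_hermite]
    simp
  refine ⟨H.comp g, ?_, ?_⟩
  · have hH₀ : H ≠ 0 := ((hermite_monic n).map _).ne_zero
    rw [Ne, comp_eq_zero_iff, not_or, not_and]
    refine ⟨hH₀, fun _ hconst => hs₀ ?_⟩
    rwa [hconst, derivative_C, eq_comm, C_eq_zero] at hg
  · have h := congrArg (·.comp g) hH
    simp only [sub_comp, mul_comp, X_comp, C_comp] at h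
    simp only [derivative_comp, derivative_mul, hg, derivative_C, h]
    rw [hcs, ← hs]
    simp only [C_mul, C_pow, g]
    ring

lemma exists_eval_ofReal_ne_zero {w : ℂ[X]} (hw : w ≠ 0) : ∃ x : ℝ, w.eval (x : ℂ) ≠ 0 := by
  by_contra! h
  have hinf : (Set.range ((↑) : ℝ → ℂ)).Infinite :=
    Set.infinite_range_of_injective Complex.ofReal_injective
  exact hw (eq_zero_of_infinite_isRoot w (hinf.mono (by rintro _ ⟨x, rfl⟩; exact h x)))

lemma hasDerivAt_eval_ofReal (w : ℂ[X]) (x : ℝ) :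
    HasDerivAt (fun t : ℝ => w.eval (t : ℂ)) (w.derivative.eval (x : ℂ)) x :=
  (w.hasDerivAt (x : ℂ)).comp_ofReal

end Hermite

section Diagonal

/-- The system `(u, v)' = (A x + B) (u, v)` for `A = diag (l₁, l₂)` and
`B = !![b₁, b₂; b₃, b₄]`, written out in components. The entries are separate arguments so that
either eigenvalue may come first. -/
def IsDiagSolution (l₁ l₂ b₁ b₂ b₃ b₄ : ℂ) (u v : ℝ → ℂ) : Prop :=
  ∀ x : ℝ, HasDerivAt u ((l₁ * x + b₁) * u x + b₂ * v x) x ∧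
    HasDerivAt v (b₃ * u x + (l₂ * x + b₄) * v x) x

variable {l₁ l₂ b₁ b₂ b₃ b₄ : ℂ}

/-- Dividing by `exp (l₁ x² / 2 + b₁ x)` leaves the second-order equation
`p'' = b₂ b₃ p - ((l₁ - l₂) x + b₁ - b₄) p'`, whose solution must have exponential moments. -/
lemma IsDiagSolution.eq_zero {u v : ℝ → ℂ} (h : IsDiagSolution l₁ l₂ b₁ b₂ b₃ b₄ u v)
    (hl₁ : 0 < l₁.re) (hb₂ : b₂ ≠ 0) (hu : MemLp u 2) (hv : MemLp v 2)
    (hn : ∀ n : ℤ, n < 0 → b₂ * b₃ ≠ (l₁ - l₂) * n) : u = 0 ∧ v = 0 := by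
  set e : ℝ → ℂ := expQuad (-l₁) (-b₁)
  have he (x : ℝ) : e x ≠ 0 := expQuad_ne_zero _ _ x
  have hre : (-l₁).re < 0 := by simpa using hl₁
  have hp : HasExpMoments fun x => u x * e x := hasExpMoments_mul_expQuad hre _ hu
  have hq : HasExpMoments fun x => b₂ • (v x * e x) :=
    (hasExpMoments_mul_expQuad hre _ hv).const_smul b₂
  have hpq (x : ℝ) : HasDerivAt (fun t => u t * e t) (b₂ • (v x * e x)) x :=
    ((h x).1.mul (hasDerivAt_expQuad _ _ x)).congr_deriv (by simp only [e, smul_eq_mul]; ring)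
  have hqp (x : ℝ) : HasDerivAt (fun t => b₂ • (v t * e t))
      ((b₂ * b₃) • (u x * e x) - ((l₁ - l₂) * x + (b₁ - b₄)) • b₂ • (v x * e x)) x :=
    (((h x).2.mul (hasDerivAt_expQuad _ _ x)).const_smul b₂).congr_deriv
      (by simp only [e, smul_eq_mul]; ring)
  have hβ (k : ℕ) : b₂ * b₃ + (l₁ - l₂) * (k + 1) ≠ 0 := fun h₀ =>
    hn (-(k + 1)) (by omega) (by push_cast; linear_combination h₀)
  have hp₀ := hp.eq_zero_of_second_order hq hpq hqp hβ
  have hu₀ : u = 0 := funext fun x => (mul_eq_zero_iff_right (he x)).1 (congrFun hp₀ x)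
  refine ⟨hu₀, funext fun x => ?_⟩
  have hq₀ : b₂ • (v x * e x) = 0 :=
    (hpq x).unique (by simp [hu₀, hasDerivAt_const])
  simpa [hb₂, he x] using hq₀

open Polynomial

lemma isDiagSolution_eval_mul_expQuad {w z : ℂ[X]}
    (hw : derivative w = (C (l₁ - l₂) * X + C (b₁ - b₄)) * w + C b₂ * z)
    (hz : derivative z = C b₃ * w) :
    IsDiagSolution l₁ l₂ b₁ b₂ b₃ b₄ (fun x => w.eval (x : ℂ) * expQuad l₂ b₄ x)
      (fun x => z.eval (x : ℂ) * expQuad l₂ b₄ x) := by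
  intro x
  constructor
  · refine ((hasDerivAt_eval_ofReal w x).mul (hasDerivAt_expQuad _ _ x)).congr_deriv ?_
    simp only [hw, eval_add, eval_mul, eval_C, eval_X]
    ring
  · refine ((hasDerivAt_eval_ofReal z x).mul (hasDerivAt_expQuad _ _ x)).congr_deriv ?_
    simp only [hz, eval_mul, eval_C]
    ring

lemma exists_isDiagSolution (hl : l₁ ≠ l₂) (hl₂ : l₂.re < 0) (hb₂ : b₂ ≠ 0) {n : ℤ} (hn : n < 0)
    (hb : b₂ * b₃ = (l₁ - l₂) * n) :
    ∃ u v : ℝ → ℂ, IsDiagSolution l₁ l₂ b₁ b₂ b₃ b₄ u v ∧ MemLp u 2 ∧ MemLp v 2 ∧ u ≠ 0 := by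
  obtain ⟨N, rfl⟩ : ∃ N : ℕ, n = -(N + 1) := ⟨(-n - 1).toNat, by omega⟩
  obtain ⟨w, hw₀, hw⟩ :=
    exists_ne_zero_derivative_derivative_eq (sub_ne_zero.2 hl) (b₁ - b₄) N
  set z : ℂ[X] := C b₂⁻¹ * (derivative w - (C (l₁ - l₂) * X + C (b₁ - b₄)) * w) with hz
  have hb₃ : b₃ = b₂⁻¹ * ((l₁ - l₂) * -(N + 1)) := by
    push_cast at hb
    rw [← hb, inv_mul_cancel_left₀ hb₂]
  have hwz : derivative w = (C (l₁ - l₂) * X + C (b₁ - b₄)) * w + C b₂ * z := by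
    rw [hz, ← mul_assoc, ← C_mul, mul_inv_cancel₀ hb₂, C_1]
    ring
  have hz' : derivative z = C b₃ * w := by
    simp only [hz, hb₃, derivative_mul, derivative_sub, hw, derivative_add, derivative_C,
      derivative_X, C_mul, C_neg, C_add, C_1]
    ring
  refine ⟨_, _, isDiagSolution_eval_mul_expQuad hwz hz', memLp_eval_mul_expQuad hl₂ _ _,
    memLp_eval_mul_expQuad hl₂ _ _, ?_⟩
  obtain ⟨x, hx⟩ := exists_eval_ofReal_ne_zero hw₀
  exact fun h => mul_ne_zero hx (expQuad_ne_zero l₂ b₄ x) (congrFun h x)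

end Diagonal

section VectorSolution

variable {n : Type*} [Fintype n] {A B A' B' P : Matrix n n ℂ} {F : ℝ → n → ℂ}

/-- `F` is a solution on the whole real line of `F' = (A x + B) F`: the vector-valued form of
`IsSolution`, in any dimension. -/
def IsVectorSolution (A B : Matrix n n ℂ) (F : ℝ → n → ℂ) : Prop :=
  ∀ x : ℝ, HasDerivAt F (((x : ℂ) • A + B).mulVec (F x)) x

lemma IsVectorSolution.mulVec_of_intertwine (hF : IsVectorSolution A B F)
    (hA : P * A = A' * P) (hB : P * B = B' * P) :
    IsVectorSolution A' B' fun x => P.mulVec (F x) := by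
  intro x
  have hP : P * ((x : ℂ) • A + B) = ((x : ℂ) • A' + B') * P := by
    rw [mul_add, add_mul, mul_smul_comm, smul_mul_assoc, hA, hB]
  have h := (P.mulVecLin.toContinuousLinearMap.restrictScalars ℝ).hasFDerivAt.comp_hasDerivAt x
    (hF x)
  refine h.congr_deriv ?_
  change P.mulVec (((x : ℂ) • A + B).mulVec (F x)) = ((x : ℂ) • A' + B').mulVec (P.mulVec (F x))
  rw [Matrix.mulVec_mulVec, Matrix.mulVec_mulVec, hP]

lemma memLp_mulVec (hF : MemLp F 2) (P : Matrix n n ℂ) :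
    MemLp (fun x => P.mulVec (F x)) 2 :=
  P.mulVecLin.toContinuousLinearMap.comp_memLp' hF

lemma isVectorSolution_expQuad_smul {v : n → ℂ} {l m : ℂ} (hA : A.mulVec v = l • v)
    (hB : B.mulVec v = m • v) : IsVectorSolution A B fun x => expQuad l m x • v := by
  intro x
  refine ((hasDerivAt_expQuad l m x).smul_const v).congr_deriv ?_
  rw [Matrix.mulVec_smul, Matrix.add_mulVec, Matrix.smul_mulVec, hA, hB]
  module

end VectorSolution

section TwoByTwo

variable {A B D : Matrix (Fin 2) (Fin 2) ℂ}

lemma hasNonzeroL2Solution_iff : HasNonzeroL2Solution A B ↔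
    ∃ F : ℝ → Fin 2 → ℂ, IsVectorSolution A B F ∧ MemLp F 2 ∧ F ≠ 0 := by
  constructor
  · rintro ⟨f, g, ⟨hfg, hf, hg⟩, hne⟩
    refine ⟨fun x => ![f x, g x], hfg, memLp_pi_iff.2 (Fin.forall_fin_two.2 ⟨hf, hg⟩), ?_⟩
    contrapose! hne
    exact ⟨funext fun x => congrFun (congrFun hne x) 0, funext fun x => congrFun (congrFun hne x) 1⟩
  · rintro ⟨F, hF, hL2, hne⟩
    have heta (x : ℝ) : ![F x 0, F x 1] = F x := by ext i; fin_cases i <;> rfl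
    refine ⟨fun x => F x 0, fun x => F x 1, ⟨?_, hL2.eval 0, hL2.eval 1⟩, ?_⟩
    · simpa only [IsSolution, heta] using fun x => hF x
    · contrapose! hne
      funext x
      rw [← heta, congrFun hne.1 x, congrFun hne.2 x]
      ext i; fin_cases i <;> rfl

lemma HasNonzeroL2Solution.conj (h : HasNonzeroL2Solution A B) (P : GL (Fin 2) ℂ) :
    HasNonzeroL2Solution (P.val * A * P⁻¹.val) (P.val * B * P⁻¹.val) := by
  rw [hasNonzeroL2Solution_iff] at h ⊢
  obtain ⟨F, hF, hL2, hne⟩ := h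
  refine ⟨_, hF.mulVec_of_intertwine (P := P.val) ?_ ?_, memLp_mulVec hL2 P.val, ?_⟩
  · simp [mul_assoc]
  · simp [mul_assoc]
  · contrapose! hne
    exact funext fun x => Matrix.mulVec_injective_of_isUnit P.isUnit (by simpa using congrFun hne x)

lemma hasNonzeroL2Solution_conj_iff (P : GL (Fin 2) ℂ) :
    HasNonzeroL2Solution (P.val * A * P⁻¹.val) (P.val * B * P⁻¹.val) ↔
      HasNonzeroL2Solution A B := by
  refine ⟨fun h => ?_, fun h => h.conj P⟩
  simpa [mul_assoc] using h.conj P⁻¹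

lemma SharesEigenvector.hasNonzeroL2Solution {l : ℂ} (h : SharesEigenvector A B l)
    (hl : l.re < 0) : HasNonzeroL2Solution A B := by
  obtain ⟨v, m, hA, hB⟩ := h
  rw [hasNonzeroL2Solution_iff]
  refine ⟨_, isVectorSolution_expQuad_smul (by simpa using hA.apply_eq_smul)
    (by simpa using hB.apply_eq_smul), memLp_pi_iff.2 fun i => (memLp_expQuad hl m).mul_const _, ?_⟩
  intro h
  exact smul_ne_zero (expQuad_ne_zero l m 0) hA.2 (congrFun h 0)

lemma fin_two_eq_or_eq_of_ne {i j : Fin 2} (hij : i ≠ j) (k : Fin 2) : k = i ∨ k = j := by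
  decide +revert

lemma isVectorSolution_diagonal_iff {d : Fin 2 → ℂ} {i j : Fin 2} (hij : i ≠ j)
    {F : ℝ → Fin 2 → ℂ} : IsVectorSolution (Matrix.diagonal d) B F ↔
      IsDiagSolution (d i) (d j) (B i i) (B i j) (B j i) (B j j) (F · i) (F · j) := by
  refine forall_congr' fun x => ?_
  have hforall (p : Fin 2 → Prop) : (∀ k, p k) ↔ p i ∧ p j :=
    ⟨fun h => ⟨h i, h j⟩, fun h k => by
      rcases fin_two_eq_or_eq_of_ne hij k with rfl | rfl
      exacts [h.1, h.2]⟩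
  have hsum (g : Fin 2 → ℂ) : ∑ k, g k = g i + g j :=
    Fintype.sum_eq_add i j hij fun k hk => absurd (fin_two_eq_or_eq_of_ne hij k) (not_or.2 hk)
  rw [hasDerivAt_pi, hforall]
  simp only [Matrix.mulVec, dotProduct, hsum, Matrix.add_apply, Matrix.smul_apply,
    Matrix.diagonal_apply_eq, Matrix.diagonal_apply_ne _ hij, Matrix.diagonal_apply_ne _ hij.symm]
  simp [mul_comm]

lemma hasNonzeroL2Solution_diagonal_iff {d : Fin 2 → ℂ} {i j : Fin 2} (hij : i ≠ j)
    (hi : 0 < (d i).re) (hj : (d j).re < 0) (hB : B i j ≠ 0) :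
    HasNonzeroL2Solution (Matrix.diagonal d) B ↔
      ∃ n : ℤ, n < 0 ∧ B i j * B j i = (d i - d j) * n := by
  have hd : d i ≠ d j := fun h => (hj.trans hi).ne (by rw [h])
  simp only [hasNonzeroL2Solution_iff, isVectorSolution_diagonal_iff hij]
  constructor
  · rintro ⟨F, hF, hL2, hne⟩
    by_contra! hn
    obtain ⟨hFi, hFj⟩ := hF.eq_zero hi hB (hL2.eval i) (hL2.eval j) hn
    refine hne (funext fun x => funext fun k => ?_)
    rcases fin_two_eq_or_eq_of_ne hij k with rfl | rfl
    exacts [congrFun hFi x, congrFun hFj x]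
  · rintro ⟨n, hn, hBn⟩
    obtain ⟨u, v, huv, hu, hv, hne⟩ := exists_isDiagSolution hd hj hB hn hBn
    refine ⟨fun x => Function.update (Function.const _ (v x)) i (u x), ?_, ?_, ?_⟩
    · simpa [hij.symm] using huv
    · refine memLp_pi_iff.2 fun k => ?_
      rcases fin_two_eq_or_eq_of_ne hij k with rfl | rfl
      · simpa using hu
      · simpa [hij.symm] using hv
    · contrapose! hne
      funext x
      simpa using congrFun (congrFun hne x) i

end TwoByTwo

section Diagonalization

open Matrix Module.End

section Field

variable {n K : Type*} [Fintype n] [DecidableEq n] [Field K] {A : Matrix n n K}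

lemma hasEigenvector_toLin'_iff {μ : K} {v : n → K} :
    HasEigenvector A.toLin' μ v ↔ A *ᵥ v = μ • v ∧ v ≠ 0 := by
  rw [hasEigenvector_iff, mem_eigenspace_iff, toLin'_apply]

lemma hasEigenvector_conj (P : GL n K) {μ : K} {v : n → K} (h : HasEigenvector A.toLin' μ v) :
    HasEigenvector (P.val * A * P⁻¹.val).toLin' μ (P.val *ᵥ v) := by
  rw [hasEigenvector_toLin'_iff] at h ⊢
  constructor
  · rw [← mulVec_smul, ← h.1, mulVec_mulVec, mulVec_mulVec, mul_assoc, ← Units.val_mul,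
      inv_mul_cancel, Units.val_one, mul_one]
  · exact fun h₀ => h.2 (mulVec_injective_of_isUnit P.isUnit (by simpa using h₀))

lemma exists_conj_eq_diagonal {μ : n → K} (hμ : Function.Injective μ)
    (hA : ∀ i, HasEigenvalue A.toLin' (μ i)) :
    ∃ P : GL n K, P.val * A * P⁻¹.val = diagonal μ := by
  choose v hv using fun i => (hA i).exists_hasEigenvector
  have hQ : IsUnit (of v)ᵀ := (isUnit_transpose _).2 <|
    linearIndependent_rows_iff_isUnit.1 (eigenvectors_linearIndependent' _ μ hμ v hv)
  obtain ⟨Q, hQv⟩ := hQ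
  have hAQ : A * Q.val = Q.val * diagonal μ := by
    ext i j
    rw [mul_diagonal, hQv, transpose_apply, of_apply, mul_comm]
    exact congrFun (hasEigenvector_toLin'_iff.1 (hv j)).1 i
  exact ⟨Q⁻¹, by rw [inv_inv, mul_assoc, hAQ, Units.inv_mul_cancel_left]⟩

end Field

variable {A B : Matrix (Fin 2) (Fin 2) ℂ}

lemma SharesEigenvector.conj {l : ℂ} (h : SharesEigenvector A B l) (P : GL (Fin 2) ℂ) :
    SharesEigenvector (P.val * A * P⁻¹.val) (P.val * B * P⁻¹.val) l :=
  let ⟨_, m, hA, hB⟩ := h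
  ⟨_, m, hasEigenvector_conj P hA, hasEigenvector_conj P hB⟩

lemma sharesEigenvector_conj_iff (P : GL (Fin 2) ℂ) {l : ℂ} :
    SharesEigenvector (P.val * A * P⁻¹.val) (P.val * B * P⁻¹.val) l ↔ SharesEigenvector A B l :=
  ⟨fun h => by simpa [mul_assoc] using h.conj P⁻¹, fun h => h.conj P⟩

lemma sharesEigenvector_diagonal {d : Fin 2 → ℂ} {i j : Fin 2} (hij : i ≠ j) (hB : B i j = 0) :
    SharesEigenvector (diagonal d) B (d j) := by
  have hne : (Pi.single j 1 : Fin 2 → ℂ) ≠ 0 := by simp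
  refine ⟨Pi.single j 1, B j j, hasEigenvector_toLin'_iff.2 ⟨?_, hne⟩,
    hasEigenvector_toLin'_iff.2 ⟨?_, hne⟩⟩
  all_goals
    ext k
    rcases fin_two_eq_or_eq_of_ne hij k with rfl | rfl <;> simp [hij, hB]

theorem hasNonzeroL2Solution_iff_of_isDiag_conj {l₁ l₂ : ℂ} (hl₁ : 0 < l₁.re) (hl₂ : l₂.re < 0)
    (hA₁ : HasEigenvalue A.toLin' l₁) (hA₂ : HasEigenvalue A.toLin' l₂)
    (hshare : ¬ SharesEigenvector A B l₂) (P : GL (Fin 2) ℂ)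
    (hP : (P.val * A * P⁻¹.val).IsDiag) :
    HasNonzeroL2Solution A B ↔ ∃ n : ℤ, n < 0 ∧
      (P.val * B * P⁻¹.val) 0 1 * (P.val * B * P⁻¹.val) 1 0 = (l₁ - l₂) * n := by
  obtain ⟨v₁, hv₁⟩ := hA₁.exists_hasEigenvector
  obtain ⟨v₂, hv₂⟩ := hA₂.exists_hasEigenvector
  have hD₁ := hasEigenvalue_of_hasEigenvector (hasEigenvector_conj P hv₁)
  have hD₂ := hasEigenvalue_of_hasEigenvector (hasEigenvector_conj P hv₂)
  rw [← sharesEigenvector_conj_iff P] at hshare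
  rw [← hasNonzeroL2Solution_conj_iff P]
  set B' := P.val * B * P⁻¹.val
  obtain ⟨d, hd⟩ : ∃ d, P.val * A * P⁻¹.val = diagonal d := ⟨_, hP.diagonal_diag.symm⟩
  rw [hd] at hshare hD₁ hD₂ ⊢
  obtain ⟨i, rfl⟩ := (hasEigenvalue_toLin'_diagonal_iff d).1 hD₁
  obtain ⟨j, rfl⟩ := (hasEigenvalue_toLin'_diagonal_iff d).1 hD₂
  have hij : i ≠ j := by rintro rfl; exact lt_asymm hl₁ hl₂
  have hB' : B' i j ≠ 0 := fun h => hshare (sharesEigenvector_diagonal hij h)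
  have hswap : ∀ i j, i ≠ j → B' 0 1 * B' 1 0 = B' i j * B' j i := by
    simp [Fin.forall_fin_two, mul_comm]
  rw [hswap i j hij, hasNonzeroL2Solution_diagonal_iff hij hl₁ hl₂ hB']

end Diagonalization

section Decay

lemma frequently_lt_of_integrable {a : ℝ → ℝ} (ha : Integrable a) {ε : ℝ} (hε : 0 < ε) :
    ∃ᶠ x in atTop, a x < ε := by
  intro h
  obtain ⟨X, hX⟩ := eventually_atTop.1 h
  have hsub : Set.Ici X ⊆ {x | ε ≤ a x} := fun x hx => not_lt.1 (hX x hx)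
  have hlt := (measure_mono hsub).trans_lt (ha.measure_ge_lt_top hε)
  simp at hlt

lemma exists_forall_le_of_eventually_cocompact {X : Type*} [TopologicalSpace X] {f : X → ℝ}
    (hf : Continuous f) {C : ℝ} (hC : ∀ᶠ x in cocompact X, f x ≤ C) : ∃ M, ∀ x, f x ≤ M := by
  obtain ⟨s, hs, hsC⟩ := mem_cocompact.1 hC
  obtain ⟨M, hM⟩ := hs.bddAbove_image hf.continuousOn
  refine ⟨max M C, fun x => ?_⟩
  by_cases hx : x ∈ s
  · exact le_max_of_le_left (hM ⟨x, hx, rfl⟩)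
  · exact le_max_of_le_right (hsC hx)

/-- Nonnegative functions `a` and `b` on the line that satisfy `a' = μ x a` and `b' = -ν x b` up to
an error of at most `K (a + b)`. For `μ, ν > 0` these are the squared norms of the expanding and
the contracting component of a linear system with dichotomy. -/
structure HyperbolicPair (μ ν K : ℝ) (a b : ℝ → ℝ) : Prop where
  left_nonneg : ∀ x, 0 ≤ a x
  right_nonneg : ∀ x, 0 ≤ b x
  left_differentiable : Differentiable ℝ a
  right_differentiable : Differentiable ℝ b
  abs_deriv_left_sub_le : ∀ x, |deriv a x - μ * x * a x| ≤ K * (a x + b x)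
  abs_deriv_right_add_le : ∀ x, |deriv b x + ν * x * b x| ≤ K * (a x + b x)

namespace HyperbolicPair

variable {μ ν K X : ℝ} {a b : ℝ → ℝ}

lemma comp_neg (h : HyperbolicPair μ ν K a b) :
    HyperbolicPair μ ν K (fun x => a (-x)) (fun x => b (-x)) where
  left_nonneg x := h.left_nonneg (-x)
  right_nonneg x := h.right_nonneg (-x)
  left_differentiable := h.left_differentiable.comp differentiable_neg
  right_differentiable := h.right_differentiable.comp differentiable_neg
  abs_deriv_left_sub_le x := by
    rw [deriv_comp_neg, ← abs_neg]
    convert h.abs_deriv_left_sub_le (-x) using 2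
    ring
  abs_deriv_right_add_le x := by
    rw [deriv_comp_neg, ← abs_neg]
    convert h.abs_deriv_right_add_le (-x) using 2
    ring

lemma monotoneOn_sub (h : HyperbolicPair μ ν K a b) (hμ : ∀ x, X ≤ x → 2 * K ≤ μ * x)
    (hν : ∀ x, X ≤ x → 2 * K ≤ ν * x) : MonotoneOn (fun x => a x - b x) (Set.Ici X) := by
  have hdiff : Differentiable ℝ fun x => a x - b x :=
    h.left_differentiable.sub h.right_differentiable
  refine monotoneOn_of_deriv_nonneg (convex_Ici X) hdiff.continuous.continuousOn
    hdiff.differentiableOn fun x hx => ?_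
  have hXx : X ≤ x := interior_subset hx
  rw [deriv_fun_sub (h.left_differentiable x) (h.right_differentiable x)]
  have ha := (abs_le.1 (h.abs_deriv_left_sub_le x)).1
  have hb := (abs_le.1 (h.abs_deriv_right_add_le x)).2
  have hμa := mul_le_mul_of_nonneg_right (hμ x hXx) (h.left_nonneg x)
  have hνb := mul_le_mul_of_nonneg_right (hν x hXx) (h.right_nonneg x)
  linarith

/-- A solution that leaves the cone `a ≤ b` never returns, and then `a` stays away from zero. -/
lemma left_le_right (h : HyperbolicPair μ ν K a b) (ha : Integrable a)
    (hμ : ∀ x, X ≤ x → 2 * K ≤ μ * x) (hν : ∀ x, X ≤ x → 2 * K ≤ ν * x) {x : ℝ} (hx : X ≤ x) :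
    a x ≤ b x := by
  by_contra! hlt
  obtain ⟨y, hay, hxy⟩ :=
    ((frequently_lt_of_integrable ha (sub_pos.2 hlt)).and_eventually (eventually_ge_atTop x)).exists
  have hmono : a x - b x ≤ a y - b y := h.monotoneOn_sub hμ hν hx (hx.trans hxy) hxy
  linarith [h.right_nonneg y]

lemma antitoneOn_exp_mul_right (h : HyperbolicPair μ ν K a b) {R : ℝ}
    (hab : ∀ x, X ≤ x → a x ≤ b x) (hK : 0 ≤ K) (hν : ∀ x, X ≤ x → 2 * K + R ≤ ν * x) :
    AntitoneOn (fun x => Real.exp (R * x) * b x) (Set.Ici X) := by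
  have hderiv (x : ℝ) : HasDerivAt (fun x => Real.exp (R * x) * b x)
      (Real.exp (R * x) * (R * b x + deriv b x)) x :=
    ((((hasDerivAt_id x).const_mul R).exp).mul
      (h.right_differentiable x).hasDerivAt).congr_deriv (by simp only [id]; ring)
  refine antitoneOn_of_hasDerivWithinAt_nonpos (convex_Ici X)
    (fun x _ => (hderiv x).continuousAt.continuousWithinAt)
    (fun x _ => (hderiv x).hasDerivWithinAt) fun x hx => ?_
  have hXx : X ≤ x := interior_subset hx
  refine mul_nonpos_of_nonneg_of_nonpos (Real.exp_pos _).le ?_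
  have hb := (abs_le.1 (h.abs_deriv_right_add_le x)).2
  have hKa := mul_le_mul_of_nonneg_left (hab x hXx) hK
  have hνb := mul_le_mul_of_nonneg_right (hν x hXx) (h.right_nonneg x)
  linarith

lemma exists_eventually_atTop_exp_mul_le (h : HyperbolicPair μ ν K a b) (hμ : 0 < μ) (hν : 0 < ν)
    (hK : 0 ≤ K) (ha : Integrable a) (R : ℝ) :
    ∃ C, ∀ᶠ x in atTop, Real.exp (R * |x|) * (a x + b x) ≤ C := by
  have hμ' : ∀ᶠ x in atTop, 2 * K ≤ μ * x :=
    (tendsto_id.const_mul_atTop hμ).eventually_ge_atTop _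
  have hν' (c : ℝ) : ∀ᶠ x in atTop, c ≤ ν * x :=
    (tendsto_id.const_mul_atTop hν).eventually_ge_atTop _
  obtain ⟨X, hX⟩ := eventually_atTop.1
    (hμ'.and ((hν' (2 * K)).and ((hν' (2 * K + R)).and (eventually_ge_atTop 0))))
  have hab (x : ℝ) (hx : X ≤ x) : a x ≤ b x :=
    h.left_le_right ha (fun y hy => (hX y hy).1) (fun y hy => (hX y hy).2.1) hx
  have hanti := h.antitoneOn_exp_mul_right hab hK fun y hy => (hX y hy).2.2.1
  refine ⟨2 * (Real.exp (R * X) * b X), eventually_atTop.2 ⟨X, fun x hx => ?_⟩⟩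
  calc Real.exp (R * |x|) * (a x + b x) ≤ Real.exp (R * x) * (b x + b x) := by
        rw [abs_of_nonneg (hX x hx).2.2.2]
        gcongr
        exact hab x hx
    _ = 2 * (Real.exp (R * x) * b x) := by ring
    _ ≤ 2 * (Real.exp (R * X) * b X) :=
        mul_le_mul_of_nonneg_left (hanti Set.self_mem_Ici hx hx) zero_le_two

theorem exists_exp_mul_le (h : HyperbolicPair μ ν K a b) (hμ : 0 < μ) (hν : 0 < ν)
    (hK : 0 ≤ K) (ha : Integrable a) (R : ℝ) :
    ∃ C, ∀ x, Real.exp (R * |x|) * (a x + b x) ≤ C := by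
  obtain ⟨C, hC⟩ := h.exists_eventually_atTop_exp_mul_le hμ hν hK ha R
  obtain ⟨D, hD⟩ := h.comp_neg.exists_eventually_atTop_exp_mul_le hμ hν hK ha.comp_neg R
  have hcont : Continuous fun x : ℝ => Real.exp (R * |x|) * (a x + b x) := by
    have := h.left_differentiable.continuous
    have := h.right_differentiable.continuous
    fun_prop
  refine exists_forall_le_of_eventually_cocompact (C := max C D) hcont ?_
  rw [cocompact_eq_atBot_atTop, eventually_sup]
  constructor
  · filter_upwards [tendsto_neg_atBot_atTop.eventually hD] with x hx
    simp only [abs_neg, neg_neg] at hx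
    exact le_max_of_le_right hx
  · filter_upwards [hC] with x hx using le_max_of_le_left hx

end HyperbolicPair

lemma abs_two_mul_inner_sub_le (l b c y z : ℂ) (x : ℝ) :
    |2 * inner ℝ y ((l * x + b) * y + c * z) - 2 * l.re * x * ‖y‖ ^ 2| ≤
      2 * (‖b‖ + ‖c‖) * (‖y‖ ^ 2 + ‖z‖ ^ 2) := by
  have hmain : inner ℝ y (l * x * y) = l.re * x * ‖y‖ ^ 2 := by
    rw [Complex.inner, mul_assoc, Complex.mul_conj', ← Complex.ofReal_pow,
      Complex.re_mul_ofReal, Complex.re_mul_ofReal]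
  have hsplit : 2 * inner ℝ y ((l * x + b) * y + c * z) - 2 * l.re * x * ‖y‖ ^ 2 =
      2 * inner ℝ y (b * y + c * z) := by
    rw [add_mul, add_assoc, inner_add_right, hmain]
    ring
  have hyz : ‖y‖ * ‖z‖ ≤ ‖y‖ ^ 2 + ‖z‖ ^ 2 := by
    nlinarith [sq_nonneg (‖y‖ - ‖z‖), sq_nonneg ‖y‖, sq_nonneg ‖z‖]
  rw [hsplit, abs_mul, abs_two, mul_assoc]
  gcongr
  calc |inner ℝ y (b * y + c * z)| ≤ ‖y‖ * (‖b‖ * ‖y‖ + ‖c‖ * ‖z‖) := by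
        refine (abs_real_inner_le_norm _ _).trans ?_
        gcongr
        simpa only [norm_mul] using norm_add_le (b * y) (c * z)
    _ = ‖b‖ * ‖y‖ ^ 2 + ‖c‖ * (‖y‖ * ‖z‖) := by ring
    _ ≤ ‖b‖ * (‖y‖ ^ 2 + ‖z‖ ^ 2) + ‖c‖ * (‖y‖ ^ 2 + ‖z‖ ^ 2) := by
        gcongr
        exact le_add_of_nonneg_right (sq_nonneg _)
    _ = (‖b‖ + ‖c‖) * (‖y‖ ^ 2 + ‖z‖ ^ 2) := by ring

lemma IsDiagSolution.hyperbolicPair {l₁ l₂ b₁ b₂ b₃ b₄ : ℂ} {u v : ℝ → ℂ}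
    (h : IsDiagSolution l₁ l₂ b₁ b₂ b₃ b₄ u v) :
    HyperbolicPair (2 * l₁.re) (-(2 * l₂.re)) (2 * (‖b₁‖ + ‖b₂‖ + ‖b₃‖ + ‖b₄‖))
      (fun x => ‖u x‖ ^ 2) (fun x => ‖v x‖ ^ 2) where
  left_nonneg _ := sq_nonneg _
  right_nonneg _ := sq_nonneg _
  left_differentiable x := (h x).1.norm_sq.differentiableAt
  right_differentiable x := (h x).2.norm_sq.differentiableAt
  abs_deriv_left_sub_le x := by
    rw [(h x).1.norm_sq.deriv]
    refine (abs_two_mul_inner_sub_le _ _ _ _ _ _).trans ?_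
    refine mul_le_mul_of_nonneg_right ?_ (by positivity)
    linarith [norm_nonneg b₃, norm_nonneg b₄]
  abs_deriv_right_add_le x := by
    rw [(h x).2.norm_sq.deriv, add_comm (b₃ * u x), neg_mul, neg_mul, ← sub_eq_add_neg,
      add_comm (‖u x‖ ^ 2)]
    refine (abs_two_mul_inner_sub_le _ _ _ _ _ _).trans ?_
    refine mul_le_mul_of_nonneg_right ?_ (by positivity)
    linarith [norm_nonneg b₁, norm_nonneg b₂]

lemma IsVectorSolution.exists_exp_mul_norm_sq_le {d : Fin 2 → ℂ} {i j : Fin 2} (hij : i ≠ j)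
    {B : Matrix (Fin 2) (Fin 2) ℂ} {F : ℝ → Fin 2 → ℂ}
    (hF : IsVectorSolution (Matrix.diagonal d) B F) (hL2 : MemLp F 2)
    (hi : 0 < (d i).re) (hj : (d j).re < 0) (R : ℝ) :
    ∃ C, ∀ x, Real.exp (R * |x|) * ‖F x‖ ^ 2 ≤ C := by
  have hpair := ((isVectorSolution_diagonal_iff hij).1 hF).hyperbolicPair
  have hint : Integrable fun x => ‖F x i‖ ^ 2 :=
    (memLp_two_iff_integrable_sq_norm (hL2.eval i).1).1 (hL2.eval i)
  obtain ⟨C, hC⟩ := hpair.exists_exp_mul_le (by positivity) (by linarith) (by positivity) hint R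
  refine ⟨C, fun x => le_trans ?_ (hC x)⟩
  gcongr
  rw [← Real.le_sqrt (norm_nonneg _) (by positivity), pi_norm_le_iff_of_nonneg (Real.sqrt_nonneg _)]
  intro k
  refine Real.le_sqrt_of_sq_le ?_
  rcases fin_two_eq_or_eq_of_ne hij k with rfl | rfl
  exacts [le_add_of_nonneg_right (sq_nonneg _), le_add_of_nonneg_left (sq_nonneg _)]

end Decay

section Schwartz

open scoped ContDiff

lemma exists_abs_pow_mul_norm_le {E : Type*} [SeminormedAddCommGroup E] {F : ℝ → E} {R C : ℝ}
    (hR : 0 < R) (hC : ∀ x, Real.exp (R * |x|) * ‖F x‖ ^ 2 ≤ C) (k : ℕ) :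
    ∃ D, ∀ x, |x| ^ k * ‖F x‖ ≤ D := by
  set c : ℝ := (2 * k).factorial / R ^ (2 * k)
  refine ⟨√(c * C), fun x => Real.le_sqrt_of_sq_le ?_⟩
  have hpow : |x| ^ (2 * k) ≤ c * Real.exp (R * |x|) := by
    have h := abs_pow_le_factorial_mul_exp_abs (2 * k) (R * x)
    rw [abs_mul, abs_of_pos hR, mul_pow] at h
    rwa [div_mul_eq_mul_div, le_div_iff₀' (by positivity)]
  calc (|x| ^ k * ‖F x‖) ^ 2 = |x| ^ (2 * k) * ‖F x‖ ^ 2 := by ring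
    _ ≤ c * Real.exp (R * |x|) * ‖F x‖ ^ 2 := by gcongr
    _ = c * (Real.exp (R * |x|) * ‖F x‖ ^ 2) := by ring
    _ ≤ c * C := by
        gcongr
        exact hC x

lemma hasTemperateGrowth_deriv {E : Type*} [NormedAddCommGroup E] [NormedSpace ℝ E] {f : ℝ → E}
    (hf : f.HasTemperateGrowth) : (deriv f).HasTemperateGrowth := by
  refine ⟨(contDiff_infty_iff_deriv.1 hf.1).2, fun n => ?_⟩
  simpa only [norm_iteratedFDeriv_eq_norm_iteratedDeriv, iteratedDeriv_succ'] using hf.2 (n + 1)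

variable {E : Type*} [NormedAddCommGroup E] [NormedSpace ℝ E] {Φ : ℝ → E →L[ℝ] E} {F : ℝ → E}

lemma exists_iteratedDeriv_eq_of_hasDerivAt (hΦ : Φ.HasTemperateGrowth)
    (hF : ∀ x, HasDerivAt F (Φ x (F x)) x) (n : ℕ) :
    ∃ Ψ : ℝ → E →L[ℝ] E, Ψ.HasTemperateGrowth ∧ iteratedDeriv n F = fun x => Ψ x (F x) := by
  induction n with
  | zero =>
    exact ⟨fun _ => .id ℝ E, .const _, by simp⟩
  | succ n ih =>
    obtain ⟨Ψ, hΨ, hn⟩ := ih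
    refine ⟨fun x => deriv Ψ x + (Ψ x).comp (Φ x), (hasTemperateGrowth_deriv hΨ).add
      ((ContinuousLinearMap.compL ℝ E E E).bilinear_hasTemperateGrowth hΨ hΦ), ?_⟩
    rw [iteratedDeriv_succ, hn]
    funext x
    exact ((hΨ.1.differentiable (by simp) x).hasDerivAt.clm_apply (hF x)).deriv

theorem exists_schwartzMap_eq_of_hasDerivAt (hΦ : Φ.HasTemperateGrowth)
    (hF : ∀ x, HasDerivAt F (Φ x (F x)) x) (hdecay : ∀ k : ℕ, ∃ C, ∀ x, |x| ^ k * ‖F x‖ ≤ C) :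
    ∃ S : SchwartzMap ℝ E, ∀ x, S x = F x := by
  choose Ψ hΨ hn using exists_iteratedDeriv_eq_of_hasDerivAt hΦ hF
  have hsmooth : ContDiff ℝ ∞ F := contDiff_of_differentiable_iteratedDeriv fun n _ => by
    rw [hn]
    exact ((hΨ n).1.differentiable (by simp)).clm_apply fun x => (hF x).differentiableAt
  refine ⟨⟨F, hsmooth, fun k n => ?_⟩, fun _ => rfl⟩
  obtain ⟨m, C, hC₀, hC⟩ := (hΨ n).norm_iteratedFDeriv_le_uniform 0
  obtain ⟨D₁, hD₁⟩ := hdecay k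
  obtain ⟨D₂, hD₂⟩ := hdecay (k + m)
  refine ⟨C * (2 ^ (m - 1) * (D₁ + D₂)), fun x => ?_⟩
  have hΨx : ‖Ψ n x‖ ≤ C * (1 + |x|) ^ m := by simpa using hC 0 le_rfl x
  rw [norm_iteratedFDeriv_eq_norm_iteratedDeriv, hn, Real.norm_eq_abs]
  calc |x| ^ k * ‖Ψ n x (F x)‖ ≤ |x| ^ k * (C * (1 + |x|) ^ m * ‖F x‖) := by
        gcongr
        exact (Ψ n x).le_of_opNorm_le hΨx _
    _ ≤ |x| ^ k * (C * (2 ^ (m - 1) * (1 ^ m + |x| ^ m)) * ‖F x‖) := by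
        gcongr
        exact add_pow_le zero_le_one (abs_nonneg x) m
    _ = C * (2 ^ (m - 1) * (|x| ^ k * ‖F x‖ + |x| ^ (k + m) * ‖F x‖)) := by ring
    _ ≤ C * (2 ^ (m - 1) * (D₁ + D₂)) := by
        gcongr
        exacts [hD₁ x, hD₂ x]

lemma IsVectorSolution.exists_schwartzMap_eq {n : Type*} [Fintype n] {A B : Matrix n n ℂ}
    {F : ℝ → n → ℂ} (hF : IsVectorSolution A B F)
    (hdecay : ∀ k : ℕ, ∃ C, ∀ x, |x| ^ k * ‖F x‖ ≤ C) :
    ∃ S : SchwartzMap ℝ (n → ℂ), ∀ x, S x = F x := by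
  let L (M : Matrix n n ℂ) : (n → ℂ) →L[ℝ] (n → ℂ) :=
    M.mulVecLin.toContinuousLinearMap.restrictScalars ℝ
  have hΦ : (fun x : ℝ => x • L A + L B).HasTemperateGrowth := by fun_prop
  refine exists_schwartzMap_eq_of_hasDerivAt hΦ (fun x => (hF x).congr_deriv ?_) hdecay
  simp [L, Matrix.add_mulVec, Matrix.smul_mulVec]

theorem IsL2Solution.isSchwartz {A B : Matrix (Fin 2) (Fin 2) ℂ} {l₁ l₂ : ℂ} {f g : ℝ → ℂ}
    (h : IsL2Solution A B f g) (hl₁ : 0 < l₁.re) (hl₂ : l₂.re < 0)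
    (hA₁ : Module.End.HasEigenvalue A.toLin' l₁) (hA₂ : Module.End.HasEigenvalue A.toLin' l₂) :
    IsSchwartz f ∧ IsSchwartz g := by
  obtain ⟨hfg, hf, hg⟩ := h
  have hl : l₁ ≠ l₂ := fun h => (hl₂.trans hl₁).ne (by rw [h])
  obtain ⟨P, hP⟩ := exists_conj_eq_diagonal (μ := ![l₁, l₂]) (by simpa using hl)
    (Fin.forall_fin_two.2 ⟨hA₁, hA₂⟩)
  have hL2 : MemLp (fun x => ![f x, g x]) 2 := memLp_pi_iff.2 (Fin.forall_fin_two.2 ⟨hf, hg⟩)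
  have hG : IsVectorSolution (Matrix.diagonal ![l₁, l₂]) (P.val * B * P⁻¹.val)
      fun x => P.val.mulVec ![f x, g x] :=
    IsVectorSolution.mulVec_of_intertwine hfg (by simp [← hP, mul_assoc]) (by simp [mul_assoc])
  obtain ⟨C, hC⟩ := hG.exists_exp_mul_norm_sq_le zero_ne_one (memLp_mulVec hL2 P.val) hl₁ hl₂ 1
  obtain ⟨S, hS⟩ := hG.exists_schwartzMap_eq (exists_abs_pow_mul_norm_le one_pos hC)
  have hcomponent (i : Fin 2) : IsSchwartz fun x => ![f x, g x] i := by
    refine ⟨SchwartzMap.postcompCLM ((ContinuousLinearMap.proj i).comp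
      P⁻¹.val.mulVecLin.toContinuousLinearMap) S, fun x => ?_⟩
    change P⁻¹.val.mulVec (S x) i = ![f x, g x] i
    rw [hS, Matrix.mulVec_mulVec, Units.inv_mul, Matrix.one_mulVec]
  exact ⟨hcomponent 0, hcomponent 1⟩

end Schwartz

theorem theorem3p1_general (A B : Matrix (Fin 2) (Fin 2) ℂ) (l₁ l₂ : ℂ) (hl₁ : 0 < l₁.re)
    (hl₂ : l₂.re < 0) (hA₁ : Module.End.HasEigenvalue (Matrix.toLin' A) l₁)
    (hA₂ : Module.End.HasEigenvalue (Matrix.toLin' A) l₂) :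
    (¬ SharesEigenvector A B l₂ →
      ∀ P : GL (Fin 2) ℂ, (P.val * A * P⁻¹.val).IsDiag →
        (HasNonzeroL2Solution A B ↔
          ∃ n : ℤ, n < 0 ∧
            (P.val * B * P⁻¹.val) 0 1 * (P.val * B * P⁻¹.val) 1 0 = (l₁ - l₂) * n)) ∧
    (SharesEigenvector A B l₂ → HasNonzeroL2Solution A B) ∧
    (∀ f g : ℝ → ℂ, IsL2Solution A B f g → IsSchwartz f ∧ IsSchwartz g) :=
  ⟨hasNonzeroL2Solution_iff_of_isDiag_conj hl₁ hl₂ hA₁ hA₂,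
    fun h => h.hasNonzeroL2Solution hl₂,
    fun _ _ h => h.isSchwartz hl₁ hl₂ hA₁ hA₂⟩

theorem theorem3p1 (A B : Matrix (Fin 2) (Fin 2) ℂ) (l₁ l₂ : ℝ) (hl₁ : 0 < l₁) (hl₂ : l₂ < 0)
    (hA₁ : Module.End.HasEigenvalue (Matrix.toLin' A) (l₁ : ℂ))
    (hA₂ : Module.End.HasEigenvalue (Matrix.toLin' A) (l₂ : ℂ)) :
    -- the criterion, for every diagonalizing `P`, outside the degenerate (triangular) case
    (¬ SharesEigenvector A B (l₂ : ℂ) →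
      ∀ P : GL (Fin 2) ℂ, (P.val * A * P⁻¹.val).IsDiag →
        (HasNonzeroL2Solution A B ↔
          ∃ n : ℤ, n < 0 ∧
            (P.val * B * P⁻¹.val) 0 1 * (P.val * B * P⁻¹.val) 1 0
              = ((l₁ : ℂ) - (l₂ : ℂ)) * (n : ℂ))) ∧
    -- in the degenerate case a nonzero square-integrable solution always exists
    (SharesEigenvector A B (l₂ : ℂ) → HasNonzeroL2Solution A B) ∧
    -- square-integrable solutions are Schwartz
    (∀ f g : ℝ → ℂ, IsL2Solution A B f g → IsSchwartz f ∧ IsSchwartz g) :=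
  theorem3p1_general A B l₁ l₂ (by simpa) (by simpa) hA₁ hA₂
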